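/- **Theorem (Asynchronous G-Lemma).** Let $M,\kappa,d$ be natural numbers and let $\|\cdot\|$ be the Euclidean norm of $\mathbb R^d$ and of $(\mathbb R^d)^\kappa$. *Network.* Let $a^{i,j}(t)\ge 0$ with $\sum_{j=1}^M a^{i,j}(t)=1$ and integers $0\le\tau^{i,j}(t)\le t$ be given ($1\le i,j\le M$, $t\in\mathbb N$). Write $(j,i)\in E(t)$ iff $a^{i,j}(t)>0$. Assume: (a) $\tau^{i,j}(t)=t$ whenever $a^{i,j}(t)=0$; $\tau^{i,i}(t)=t$; and there is an integer $B_1>0$ with $t-B_1<\tau^{i,j}(t)\le t$ for all $i,j,t$; (b) there is $\alpha>0$ with $a^{i,i}(t)\ge\alpha$ and $a^{i,j}(t)\in\{0\}\cup[\alpha,1]$ for all $i,j,t$; (c) the directed graph $(\{1,\dots,M\},\bigcup_{s\ge t}E(s))$ is strongly connected for every $t$; (d) at least one of the following holds: (d1) whenever $(i,j)\in E(t)$ for infinitely many $t$, there is an integer $B_2>0$ with $(i,j)\in E(t)\cup\dots\cup E(t+B_2-1)$ for all $t$; (d2) there is $B_3>0$ such that $(i,j)\in E(t)$ implies $(j,i)\in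 E(\tau)$ for some $\tau$ with $|t-\tau|<B_3$. For the iterations $w^i(t+1)=\sum_j a^{i,j}(t)w^j(\tau^{i,j}(t))+s^i(t)$, let $\phi^{i,j}(t,\tau)$, $-1\le\tau<t$, be the real coefficients, depending only on the network, such that $w^i(t)=\sum_j\phi^{i,j}(t,-1)w^j(0)+\sum_{\tau=0}^{t-1}\sum_j\phi^{i,j}(t,\tau)s^j(\tau)$ for all initial values and descent terms, and let $\phi^j(\tau)=\lim_{t\to\infty}\phi^{i,j}(t,\tau)$, a limit which does not depend on $i$. *Quantization.* Let $\mu$ be a probability measure on $\mathbb R^d$ with a bounded density with respect to the Lebesgue measure, whose support is equal to its closed convex hull $\mathcal G$, and assume that $\mathcal G$ is compact. For $w\in(\mathbb R^d)^\kappa$, let $W_\ell(w)=\{v\in\mathcal G:\|w_\ell-v\|<\|w_k-v\|\text{ for all }k\text{ with }w_k\ne w_\ell\}$ if $\ell=\min\{k:w_k=w_\ell\}$, and $W_\ell(w)=\emptyset$ otherwise. Set $H(z,w)=\big((w_\ell-z)\mathbf 1_{\{z\in W_\ell(w)\}}\big)_{1\le\ell\le\kappa}$ and $h(w)=\int_{\mathcal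 G}H(z,w)\,d\mu(z)$. *Algorithm.* Let $z^i_t$ ($1\le i\le M$, $t\ge1$) be independent random variables of law $\mu$ on a probability space, $\varepsilon^i_t\in(0,1)$ deterministic steps, $T^i\subset\mathbb N$ deterministic sets, and $w^i(0)\in(\mathbb R^d)^\kappa$ deterministic initial values. Let $w^i(t)$ be given by the above iterations with $s^i(t)=-\varepsilon^i_{t+1}H(z^i_{t+1},w^i(t))$ if $t\in T^i$ and $s^i(t)=0$ otherwise. Define the agreement vector and the steps $$w^\star(t)=\sum_j\phi^j(-1)w^j(0)+\sum_{\tau=0}^{t-1}\sum_j\phi^j(\tau)s^j(\tau),\qquad \varepsilon^\star_{t+1}=\sum_j\mathbf 1_{\{t\in T^j\}}\phi^j(t)\varepsilon^j_{t+1}\qquad(t\ge0),$$ and $$\Delta M^{(1)}_t=\sum_j\mathbf 1_{\{t\in T^j\}}\phi^j(t)\varepsilon^j_{t+1}\big(h(w^\star(t))-h(w^j(t))\big),\qquad \Delta M^{(2)}_t=\sum_j\mathbf 1_{\{t\in T^j\}}\phi^j(t)\varepsilon^j_{t+1}\big(h(w^j(t))-H(z^j_{t+1},w^j(t))\big).$$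 Suppose that 1. $\sum_{t\ge0}\varepsilon^\star_{t+1}=\infty$ and $\varepsilon^\star_t\to0$ as $t\to\infty$; 2. the sequences $(w^\star(t))_{t\ge0}$ and $(h(w^\star(t)))_{t\ge0}$ are bounded almost surely; 3. the series $\sum_{t\ge0}\Delta M^{(1)}_t$ and $\sum_{t\ge0}\Delta M^{(2)}_t$ converge almost surely in $(\mathbb R^d)^\kappa$; 4. $G:(\mathbb R^d)^\kappa\to[0,\infty)$ is a lower semicontinuous function with $\sum_{t\ge0}\varepsilon^\star_{t+1}G(w^\star(t))<\infty$ almost surely. Then there is a random connected component $\Xi$ of $\{G=0\}$, namely the connected component in $\{G=0\}$ of a random variable $\xi$ which lies almost surely in $\{G=0\}$, such that $$\operatorname{dist}(w^\star(t),\Xi)\xrightarrow[t\to\infty]{}0\quad\text{almost surely.}$$ -/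

import Mathlib

open MeasureTheory ProbabilityTheory Filter Topology

/-- `ℝ^d` with its Euclidean norm. -/
abbrev Pt (d : ℕ) : Type := EuclideanSpace ℝ (Fin d)

/-- The space `(ℝ^d)^κ` of quantizers, with its Euclidean norm. -/
abbrev Quantizer (κ d : ℕ) : Type := PiLp 2 (fun _ : Fin κ => Pt d)

/-! ### Distributed asynchronous iterations -/

/-- Combining coefficients `a i j t` and (deterministic) time instants `tau i j t` of a network of
`M` processors: agent `i` combines at time `t` the versions `w^j (tau i j t)`, with convex
weights. -/
structure AsyncNetwork (M : ℕ) where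
  a : Fin M → Fin M → ℕ → ℝ
  tau : Fin M → Fin M → ℕ → ℕ
  a_nonneg : ∀ i j t, 0 ≤ a i j t
  a_sum : ∀ i t, ∑ j, a i j t = 1
  tau_le : ∀ i j t, tau i j t ≤ t

namespace AsyncNetwork

variable {M : ℕ} (N : AsyncNetwork M)

/-- The iterations `w^i(t+1) = ∑ j, a^{i,j}(t) w^j(τ^{i,j}(t)) + s^i(t)`; the descent term of
agent `i` at time `t` may depend on its current version, `s^i(t) = s i t (w^i(t))`. -/
noncomputable def iterate {V : Type*} [AddCommGroup V] [Module ℝ V]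
    (w0 : Fin M → V) (s : Fin M → ℕ → V → V) : ℕ → Fin M → V
  | 0, i => w0 i
  | t + 1, i =>
      (∑ j, N.a i j t • iterate w0 s (N.tau i j t) j) + s i t (iterate w0 s t i)
  termination_by t => t
  decreasing_by
  · exact Nat.lt_succ_of_le (N.tau_le _ _ _)
  · exact Nat.lt_succ_self _

/-- The coefficient `φ^{i,j}(t, σ - 1)`: the value held by agent `i` at time `t` in the real-valued
iterations whose only nonzero input is a unit input of agent `j`, namely the initial value
`w^j(0) = 1` if `σ = 0`, and the descent term `s^j(σ - 1) = 1` if `σ ≥ 1`. -/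
noncomputable def coeff (i j : Fin M) (t σ : ℕ) : ℝ :=
  N.iterate (fun k => if k = j ∧ σ = 0 then (1 : ℝ) else 0)
    (fun k τ _ => if k = j ∧ σ = τ + 1 then (1 : ℝ) else 0) t i

theorem coeff_succ (i j : Fin M) (t σ : ℕ) :
    N.coeff i j (t + 1) σ = (∑ k, N.a i k t * N.coeff k j (N.tau i k t) σ) +
      if i = j ∧ σ = t + 1 then 1 else 0 := by
  rw [coeff, iterate]
  simp only [smul_eq_mul, coeff]

theorem coeff_eq_zero (j : Fin M) (σ : ℕ) : ∀ (t : ℕ) (i : Fin M), t < σ →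
    N.coeff i j t σ = 0 := by
  intro t
  induction t using Nat.strong_induction_on with
  | _ t ih =>
    intro i ht
    cases t with
    | zero => rw [coeff, iterate, if_neg (by omega)]
    | succ t =>
      rw [coeff_succ, if_neg (by omega), add_zero]
      refine Finset.sum_eq_zero fun k _ => ?_
      have := N.tau_le i k t
      rw [ih _ (by omega) k (by omega), mul_zero]

/-- The coefficients `coeff i j t σ` are those of the linear decomposition of the versions with
respect to the initial values and the descent terms. -/
theorem iterate_eq_sum_coeff {V : Type*} [AddCommGroup V] [Module ℝ V]
    (w0 : Fin M → V) (s : Fin M → ℕ → V) (t : ℕ) (i : Fin M) :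
    N.iterate w0 (fun k τ _ => s k τ) t i =
      (∑ j, N.coeff i j t 0 • w0 j) +
        ∑ τ ∈ Finset.range t, ∑ j, N.coeff i j t (τ + 1) • s j τ := by
  have key : ∀ (t : ℕ) (i : Fin M) (n : ℕ), t ≤ n → N.iterate w0 (fun k τ _ => s k τ) t i =
      (∑ j, N.coeff i j t 0 • w0 j) +
        ∑ τ ∈ Finset.range n, ∑ j, N.coeff i j t (τ + 1) • s j τ := by
    intro t
    induction t using Nat.strong_induction_on with
    | _ t ih =>
      intro i n hn
      cases t with
      | zero =>
        rw [iterate, Finset.sum_eq_zero (s := Finset.range n), add_zero]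
        · simp [coeff, iterate, ite_smul]
        · intro τ _
          exact Finset.sum_eq_zero fun j _ => by
            rw [N.coeff_eq_zero j _ 0 i (by omega), zero_smul]
      | succ t =>
        have h1 : ∀ k, N.iterate w0 (fun k τ _ => s k τ) (N.tau i k t) k =
            (∑ j, N.coeff k j (N.tau i k t) 0 • w0 j) + ∑ τ ∈ Finset.range n, ∑ j,
              N.coeff k j (N.tau i k t) (τ + 1) • s j τ := fun k => by
          have := N.tau_le i k t
          exact ih _ (by omega) k n (by omega)
        have h2 : ∑ τ ∈ Finset.range n, ∑ j,
            (if i = j ∧ τ + 1 = t + 1 then (1 : ℝ) else 0) • s j τ = s i t := by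
          rw [Finset.sum_eq_single t, Finset.sum_eq_single i]
          · simp
          · intro j _ hj
            simp [Ne.symm hj]
          · simp
          · intro τ _ hτ
            simp [hτ]
          · intro h
            exact absurd (Finset.mem_range.2 (by omega)) h
        rw [iterate]
        simp only [h1, coeff_succ, add_smul, Finset.sum_add_distrib, h2, smul_add, Finset.smul_sum,
          Finset.sum_smul, smul_smul]
        rw [← add_assoc]
        congr 1
        congr 1
        · rw [Finset.sum_comm]
          simp
        · rw [Finset.sum_comm]
          refine Finset.sum_congr rfl fun τ _ => Finset.sum_comm
  exact key t i t le_rfl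

open Classical in
/-- The limit `φ^j(σ - 1)` of `φ^{i,j}(t, σ - 1)` as `t → ∞`, common to all agents `i`
(by convention `0` if there is no such common limit). -/
noncomputable def limCoeff (j : Fin M) (σ : ℕ) : ℝ :=
  if h : ∃ l : ℝ, ∀ i, Tendsto (fun t => N.coeff i j t σ) atTop (𝓝 l) then h.choose else 0

/-- The agreement vector
`w⋆(t) = ∑ j, φ^j(-1) w^j(0) + ∑ τ < t, ∑ j, φ^j(τ) s^j(τ)`. -/
noncomputable def agreement {V : Type*} [AddCommGroup V] [Module ℝ V]
    (w0 : Fin M → V) (s : Fin M → ℕ → V) (t : ℕ) : V :=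
  (∑ j, N.limCoeff j 0 • w0 j) +
    ∑ τ ∈ Finset.range t, ∑ j, N.limCoeff j (τ + 1) • s j τ

/-- `(j, i)` is an edge of the communication graph at time `t`. -/
def Edge (t : ℕ) (j i : Fin M) : Prop := 0 < N.a i j t

/-- Bounded communication delays. -/
def BoundedDelays : Prop :=
  (∀ i j t, N.a i j t = 0 → N.tau i j t = t) ∧
  (∀ i t, N.tau i i t = t) ∧
  ∃ B₁ : ℕ, 0 < B₁ ∧ ∀ i j t, t < N.tau i j t + B₁ ∧ N.tau i j t ≤ t

/-- Convex combination and threshold. -/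
def ConvexThreshold : Prop :=
  ∃ α : ℝ, 0 < α ∧
    (∀ i t, α ≤ N.a i i t) ∧
    (∀ i j t, N.a i j t = 0 ∨ N.a i j t ∈ Set.Icc α 1) ∧
    (∀ i t, ∑ j, N.a i j t = 1)

/-- For every `t`, the union of the communication graphs at times `s ≥ t` is strongly
connected. -/
def GraphConnectivity : Prop :=
  ∀ (t : ℕ) (i j : Fin M), Relation.ReflTransGen (fun k l => ∃ s, t ≤ s ∧ N.Edge s k l) i j

/-- Bounded communication intervals. -/
def BoundedIntervals : Prop :=
  ∀ i j : Fin M, {t : ℕ | N.Edge t i j}.Infinite →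
    ∃ B₂ : ℕ, 0 < B₂ ∧ ∀ t : ℕ, ∃ r < B₂, N.Edge (t + r) i j

/-- Symmetry of the communications. -/
def Symmetry : Prop :=
  ∃ B₃ : ℕ, 0 < B₃ ∧ ∀ (i j : Fin M) (t : ℕ), N.Edge t i j →
    ∃ τ : ℕ, |(t : ℤ) - τ| < B₃ ∧ N.Edge τ j i

/-- The first set of assumptions on the network. -/
def AsY₁ : Prop :=
  N.BoundedDelays ∧ N.ConvexThreshold ∧ N.GraphConnectivity ∧ N.BoundedIntervals

/-- The second set of assumptions on the network. -/
def AsY₂ : Prop :=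
  N.BoundedDelays ∧ N.ConvexThreshold ∧ N.GraphConnectivity ∧ N.Symmetry

end AsyncNetwork

/-! ### Quantization -/

/-- The closed convex hull of the support of `μ`. -/
noncomputable def hullSupport {d : ℕ} (μ : Measure (Pt d)) : Set (Pt d) :=
  closedConvexHull ℝ μ.support

/-- `μ` has a bounded density with respect to the Lebesgue measure, its support is equal to its
closed convex hull, and the latter is compact. -/
def CompactSupportedDensity {d : ℕ} (μ : Measure (Pt d)) : Prop :=
  (∃ (f : Pt d → ENNReal) (K : NNReal), Measurable f ∧ (∀ x, f x ≤ K) ∧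
    μ = (volume : Measure (Pt d)).withDensity f) ∧
  μ.support = hullSupport μ ∧ IsCompact (hullSupport μ)

/-- The `ℓ`-th Voronoï cell `W_ℓ(w)` of the closed convex hull of the support of `μ`.  If several
components of `w` coincide with `w_ℓ`, only the one with the smallest index has a nonempty cell; if
the components of `w` are pairwise distinct, the second clause is void and `w k ≠ w ℓ` means
`k ≠ ℓ`. -/
def voronoiCell {κ d : ℕ} (μ : Measure (Pt d)) (w : Quantizer κ d) (ℓ : Fin κ) : Set (Pt d) :=
  {v | v ∈ hullSupport μ ∧ (∀ k, w k = w ℓ → ℓ ≤ k) ∧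
    ∀ k, w k ≠ w ℓ → ‖w ℓ - v‖ < ‖w k - v‖}

/-- `H(z, w) = ((w_ℓ - z) 1_{z ∈ W_ℓ(w)})_ℓ`. -/
noncomputable def gradObs {κ d : ℕ} (μ : Measure (Pt d)) (z : Pt d) (w : Quantizer κ d) :
    Quantizer κ d :=
  WithLp.toLp 2 fun ℓ => (voronoiCell μ w ℓ).indicator (fun x => w ℓ - x) z

/-- The average function `h(w) = ∫ H(z, w) dμ(z)`. -/
noncomputable def avgGrad {κ d : ℕ} (μ : Measure (Pt d)) (w : Quantizer κ d) : Quantizer κ d :=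
  ∫ z in hullSupport μ, gradObs μ z w ∂μ

/-! ### The distributed asynchronous learning vector quantization algorithm -/

/-- The deterministic parameters of the algorithm: the network, the set `T i` of the times at which
agent `i` performs a descent step, the `(0,1)`-valued steps `eps i t` and the initial versions. -/
structure DALVQ (M κ d : ℕ) where
  net : AsyncNetwork M
  T : Fin M → Set ℕ
  eps : Fin M → ℕ → ℝ
  eps_mem : ∀ i t, eps i t ∈ Set.Ioo (0 : ℝ) 1
  init : Fin M → Quantizer κ d

namespace DALVQ

variable {M κ d : ℕ} (A : DALVQ M κ d) (μ : Measure (Pt d))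

/-- `1_{t ∈ T^j} φ^j(t) ε^j_{t+1}`. -/
noncomputable def weight (j : Fin M) (t : ℕ) : ℝ :=
  (A.T j).indicator (fun t => A.net.limCoeff j (t + 1) * A.eps j (t + 1)) t

/-- `epsStar t` is `ε⋆_{t+1} = ∑ j, 1_{t ∈ T^j} φ^j(t) ε^j_{t+1}`. -/
noncomputable def epsStar (t : ℕ) : ℝ := ∑ j, A.weight j t

/-- The version `w^i(t)` of agent `i`, when `z i t` is the value of the observation `z^i_t`
(`t ≥ 1`). -/
noncomputable def version (z : Fin M → ℕ → Pt d) (i : Fin M) (t : ℕ) : Quantizer κ d :=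
  A.net.iterate A.init
    (fun i t w => (A.T i).indicator (fun t => -(A.eps i (t + 1) • gradObs μ (z i (t + 1)) w)) t)
    t i

/-- The descent term `s^i(t) = -ε^i_{t+1} H(z^i_{t+1}, w^i(t))` if `t ∈ T^i`, and `0`
otherwise. -/
noncomputable def descent (z : Fin M → ℕ → Pt d) (i : Fin M) (t : ℕ) : Quantizer κ d :=
  (A.T i).indicator
    (fun t => -(A.eps i (t + 1) • gradObs μ (z i (t + 1)) (A.version μ z i t))) t

/-- The agreement vector `w⋆(t)` of the algorithm. -/
noncomputable def wStar (z : Fin M → ℕ → Pt d) (t : ℕ) : Quantizer κ d :=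
  A.net.agreement A.init (A.descent μ z) t

/-- `ΔM^{(1)}_t = ∑ j, 1_{t ∈ T^j} φ^j(t) ε^j_{t+1} (h(w⋆(t)) - h(w^j(t)))`. -/
noncomputable def deltaM₁ (z : Fin M → ℕ → Pt d) (t : ℕ) : Quantizer κ d :=
  ∑ j, A.weight j t • (avgGrad μ (A.wStar μ z t) - avgGrad μ (A.version μ z j t))

/-- `ΔM^{(2)}_t = ∑ j, 1_{t ∈ T^j} φ^j(t) ε^j_{t+1} (h(w^j(t)) - H(z^j_{t+1}, w^j(t)))`. -/
noncomputable def deltaM₂ (z : Fin M → ℕ → Pt d) (t : ℕ) : Quantizer κ d :=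
  ∑ j, A.weight j t •
    (avgGrad μ (A.version μ z j t) - gradObs μ (z j (t + 1)) (A.version μ z j t))

end DALVQ

/-!
By construction the agreement vector satisfies
`w⋆(t+1) = w⋆(t) - ε⋆_{t+1} h(w⋆(t)) + ΔM⁽¹⁾_t + ΔM⁽²⁾_t`, so almost every trajectory is a gradient
descent perturbed by a convergent series. If such a trajectory clusters at `x`, it spends an
infinite amount of time, measured by the steps, in every neighbourhood of `x`: otherwise its total
displacement inside the neighbourhood would have convergent partial sums and the trajectory could
never leave, although the steps are not summable. Near a point with `G x > 0` the lower
semicontinuous `G` is bounded below, so `∑ ε⋆ G(w⋆) < ∞` forces `G = 0` at all cluster points.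
Since the increments tend to `0` and the trajectory is relatively compact, the cluster points form a
connected set, hence lie in a single component of `{G = 0}`. A measurable choice of a cluster point
comes from the Kuratowski–Ryll-Nardzewski selection theorem.
-/

section ClusterPoints

theorem eventually_of_frequently_of_eventually_imp_succ {p : ℕ → Prop}
    (hp : ∃ᶠ t in atTop, p t) (hsucc : ∀ᶠ t in atTop, p t → p (t + 1)) :
    ∀ᶠ t in atTop, p t := by
  obtain ⟨N, hN⟩ := eventually_atTop.1 hsucc
  obtain ⟨m, hNm, hm⟩ := frequently_atTop.1 hp N
  exact eventually_atTop.2 ⟨m, fun t ht =>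
    Nat.le_induction hm (fun n hn => hN n (hNm.trans hn)) t ht⟩

theorem isCompact_setOfPred_mapClusterPt {ι E : Type*} [TopologicalSpace E] [R1Space E]
    {l : Filter ι} {w : ι → E} {K : Set E} (hK : IsCompact K) (hwK : ∀ᶠ t in l, w t ∈ K) :
    IsCompact {x | MapClusterPt x l w} :=
  hK.closure.of_isClosed_subset isClosed_setOfPred_clusterPt fun _ hx =>
    isClosed_closure.mem_of_mapClusterPt hx (hwK.mono fun _ ht => subset_closure ht)

variable {E : Type*} [PseudoMetricSpace E]

theorem isPreconnected_setOfPred_mapClusterPt {w : ℕ → E} {K : Set E} (hK : IsCompact K)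
    (hwK : ∀ᶠ t in atTop, w t ∈ K)
    (hinc : Tendsto (fun t => dist (w (t + 1)) (w t)) atTop (𝓝 0)) :
    IsPreconnected {x | MapClusterPt x atTop w} := by
  set L := {x | MapClusterPt x atTop w}
  have hLc : IsCompact L := isCompact_setOfPred_mapClusterPt hK hwK
  have hLcl : IsClosed L := isClosed_setOfPred_clusterPt
  refine isPreconnected_closed_iff.2 fun A B hA hB hLAB ⟨a, haL, haA⟩ ⟨b, hbL, hbB⟩ => ?_
  by_contra hAB
  have hdisj : Disjoint (L ∩ A) (L ∩ B) :=
    Set.disjoint_left.2 fun x hxA hxB => hAB ⟨x, hxA.1, hxA.2, hxB.2⟩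
  obtain ⟨δ, hδ, hth⟩ := hdisj.exists_thickenings (hLc.inter_right hA) (hLcl.inter hB)
  have hhalf (s : Set E) : Metric.thickening (δ / 2) s ⊆ Metric.thickening δ s :=
    Metric.thickening_mono (half_le_self hδ.le) s
  have hnear : ∀ᶠ t in atTop,
      w t ∈ Metric.thickening (δ / 2) (L ∩ A) ∪ Metric.thickening (δ / 2) (L ∩ B) := by
    refine hK.tendsto_nhdsSet_of_mapClusterPt (s' := L) hwK (fun _ _ hx => hx) ?_
    rw [← Metric.thickening_union, ← Set.inter_union_distrib_left, Set.inter_eq_left.2 hLAB]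
    exact Metric.thickening_mem_nhdsSet L (half_pos hδ)
  have hstep : ∀ᶠ t in atTop, w t ∈ Metric.thickening (δ / 2) (L ∩ A) →
      w (t + 1) ∈ Metric.thickening (δ / 2) (L ∩ A) := by
    filter_upwards [(tendsto_add_atTop_nat 1).eventually hnear,
      hinc.eventually (gt_mem_nhds (half_pos hδ))] with t hnext hsmall ht
    refine hnext.resolve_right fun hB => Set.disjoint_left.1 hth ?_ (hhalf _ hB)
    obtain ⟨y, hy, hty⟩ := Metric.mem_thickening_iff.1 ht
    exact Metric.mem_thickening_iff.2 ⟨y, hy, by linarith [dist_triangle (w (t + 1)) (w t) y]⟩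
  have hfreq {s : Set E} {x : E} (hxL : x ∈ L) (hx : x ∈ s) :
      ∃ᶠ t in atTop, w t ∈ Metric.thickening (δ / 2) s :=
    MapClusterPt.frequently hxL
      (Metric.isOpen_thickening.mem_nhds (Metric.self_subset_thickening (half_pos hδ) s hx))
  have hinA := eventually_of_frequently_of_eventually_imp_succ
    (hfreq (s := L ∩ A) haL ⟨haL, haA⟩) hstep
  obtain ⟨t, htB, htA⟩ := ((hfreq (s := L ∩ B) hbL ⟨hbL, hbB⟩).and_eventually hinA).exists
  exact Set.disjoint_left.1 hth (hhalf _ htA) (hhalf _ htB)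

theorem tendsto_infDist_of_tendsto_nhdsSet {ι : Type*} {l : Filter ι} {w : ι → E} {s : Set E}
    (h : Tendsto w l (𝓝ˢ s)) : Tendsto (fun t => Metric.infDist (w t) s) l (𝓝 0) := by
  rcases s.eq_empty_or_nonempty with rfl | hs
  · simp only [Metric.infDist_empty, tendsto_const_nhds]
  refine tendsto_order.2 ⟨fun r hr => .of_forall fun t => hr.trans_le Metric.infDist_nonneg,
    fun r hr => ?_⟩
  filter_upwards [h (Metric.thickening_mem_nhdsSet s hr)] with t ht
  exact (Metric.mem_thickening_iff_infDist_lt hs).1 ht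

end ClusterPoints

section PerturbedDescent

variable {E : Type*} [SeminormedAddCommGroup E]

theorem tendsto_zero_of_cauchySeq_sum_range {u : ℕ → E}
    (hu : CauchySeq fun n => ∑ t ∈ Finset.range n, u t) : Tendsto u atTop (𝓝 0) := by
  rw [tendsto_zero_iff_norm_tendsto_zero]
  have hpair : Tendsto (fun n : ℕ => (n + 1, n)) atTop atTop := by
    rw [← prod_atTop_atTop_eq]
    exact (tendsto_add_atTop_nat 1).prodMk tendsto_id
  simpa [Function.comp_def, dist_eq_norm, Finset.sum_range_succ] using
    (cauchySeq_iff_tendsto_dist_atTop_0.1 hu).comp hpair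

theorem eventually_mem_of_mapClusterPt_of_cauchySeq {w u : ℕ → E} {x : E} {U : Set E}
    (hU : U ∈ 𝓝 x) (hx : MapClusterPt x atTop w)
    (hu : CauchySeq fun n => ∑ t ∈ Finset.range n, u t)
    (hsucc : ∀ t, w t ∈ U → w (t + 1) = w t + u t) : ∀ᶠ t in atTop, w t ∈ U := by
  obtain ⟨r, hr, hball⟩ := Metric.mem_nhds_iff.1 hU
  obtain ⟨N, hN⟩ := Metric.cauchySeq_iff.1 hu (r / 2) (half_pos hr)
  obtain ⟨m, hmx, hNm⟩ := ((hx.frequently (Metric.ball_mem_nhds x (half_pos hr))).and_eventually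
    (eventually_ge_atTop N)).exists
  have hmem {n : ℕ} (hn : m ≤ n) (hwn : w n - w m =
      ∑ t ∈ Finset.range n, u t - ∑ t ∈ Finset.range m, u t) : w n ∈ U := by
    have hdist : dist (w n) (w m) < r / 2 := by
      rw [dist_eq_norm, hwn, ← dist_eq_norm]
      exact hN n (hNm.trans hn) m hNm
    exact hball (by rw [Metric.mem_ball]; linarith [dist_triangle (w n) (w m) x])
  have hdisp : ∀ n, m ≤ n →
      w n - w m = ∑ t ∈ Finset.range n, u t - ∑ t ∈ Finset.range m, u t := fun n hn => by
    induction n, hn using Nat.le_induction with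
    | base => rw [sub_self, sub_self]
    | succ n hn ih =>
      rw [hsucc n (hmem hn ih), Finset.sum_range_succ, add_sub_right_comm, ih,
        add_sub_right_comm]
  exact eventually_atTop.2 ⟨m, fun n hn => hmem hn (hdisp n hn)⟩

variable [NormedSpace ℝ E]

/-- The trajectory `w` of a descent scheme of steps `ε` along a bounded drift `v`, perturbed by
errors `δ` with convergent partial sums. No relation between `v` and `w` is imposed: the scheme of
the theorem has `v t = h (w t)`, for a discontinuous `h`. -/
structure IsPerturbedDescent (ε : ℕ → ℝ) (v δ w : ℕ → E) : Prop where
  step_nonneg : ∀ t, 0 ≤ ε t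
  not_summable_step : ¬ Summable ε
  drift_bounded : ∃ C, ∀ t, ‖v t‖ ≤ C
  cauchySeq_sum_error : CauchySeq fun n => ∑ t ∈ Finset.range n, δ t
  succ_eq : ∀ t, w (t + 1) = w t - ε t • v t + δ t

namespace IsPerturbedDescent

variable {ε : ℕ → ℝ} {v δ w : ℕ → E} {x : E}

theorem not_summable_indicator_step (h : IsPerturbedDescent ε v δ w)
    (hx : MapClusterPt x atTop w) {U : Set E} (hU : U ∈ 𝓝 x) :
    ¬ Summable ({t | w t ∈ U}.indicator ε) := by
  intro hsum
  set e := {t | w t ∈ U}.indicator ε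
  have heq {t : ℕ} (ht : w t ∈ U) : e t = ε t := Set.indicator_of_mem (s := {t | w t ∈ U}) ht ε
  have he (t : ℕ) : 0 ≤ e t := Set.indicator_nonneg (fun t _ => h.step_nonneg t) t
  obtain ⟨C, hC⟩ := h.drift_bounded
  have hdrift : CauchySeq fun n => ∑ t ∈ Finset.range n, e t • v t := by
    refine cauchySeq_range_of_norm_bounded
      (hsum.mul_right C).hasSum.tendsto_sum_nat.cauchySeq fun t => ?_
    rw [norm_smul, Real.norm_of_nonneg (he t)]
    exact mul_le_mul_of_nonneg_left (hC t) (he t)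
  have hmem : ∀ᶠ t in atTop, w t ∈ U := by
    refine eventually_mem_of_mapClusterPt_of_cauchySeq (u := fun t => δ t + -(e t • v t)) hU hx ?_
      fun t ht => ?_
    · simpa only [Finset.sum_add_distrib, Finset.sum_neg_distrib, Pi.add_def, Pi.neg_def] using
        h.cauchySeq_sum_error.add hdrift.neg
    · rw [h.succ_eq, heq ht]
      abel
  exact h.not_summable_step (hsum.congr_atTop (hmem.mono fun t ht => heq ht))

theorem eq_zero_of_mapClusterPt (h : IsPerturbedDescent ε v δ w) {G : E → ℝ}
    (hG : LowerSemicontinuousAt G x) (hG_nonneg : ∀ y, 0 ≤ G y)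
    (hG_sum : Summable fun t => ε t * G (w t)) (hx : MapClusterPt x atTop w) : G x = 0 := by
  by_contra hne
  have hpos : 0 < G x := (hG_nonneg x).lt_of_ne' hne
  refine h.not_summable_indicator_step hx (hG (G x / 2) (half_lt_self hpos))
    ((summable_mul_right_iff (half_pos hpos).ne').1 (hG_sum.of_nonneg_of_le
      (fun t => mul_nonneg (Set.indicator_nonneg (fun t _ => h.step_nonneg t) t)
        (half_pos hpos).le) fun t => ?_))
  rw [Set.indicator_apply]
  split_ifs with ht
  · exact mul_le_mul_of_nonneg_left (le_of_lt ht) (h.step_nonneg t)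
  · rw [zero_mul]
    exact mul_nonneg (h.step_nonneg t) (hG_nonneg _)

theorem tendsto_dist_succ (h : IsPerturbedDescent ε v δ w) (hε : Tendsto ε atTop (𝓝 0)) :
    Tendsto (fun t => dist (w (t + 1)) (w t)) atTop (𝓝 0) := by
  obtain ⟨C, hC⟩ := h.drift_bounded
  have hdrift : Tendsto (ε • v) atTop (𝓝 0) :=
    NormedField.tendsto_zero_smul_of_tendsto_zero_of_bounded hε (isBoundedUnder_of ⟨C, hC⟩)
  have hinc := ((tendsto_zero_of_cauchySeq_sum_range h.cauchySeq_sum_error).sub hdrift).norm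
  rw [sub_zero, norm_zero] at hinc
  refine hinc.congr fun t => ?_
  rw [dist_eq_norm, h.succ_eq, Pi.smul_apply']
  congr 1
  abel

theorem tendsto_infDist_connectedComponentIn (h : IsPerturbedDescent ε v δ w)
    (hε : Tendsto ε atTop (𝓝 0)) {K : Set E} (hK : IsCompact K) (hwK : ∀ t, w t ∈ K) {G : E → ℝ}
    (hG : LowerSemicontinuous G) (hG_nonneg : ∀ y, 0 ≤ G y)
    (hG_sum : Summable fun t => ε t * G (w t)) (hx : MapClusterPt x atTop w) :
    Tendsto (fun t => Metric.infDist (w t) (connectedComponentIn {y | G y = 0} x))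
      atTop (𝓝 0) := by
  have hsub : {y | MapClusterPt y atTop w} ⊆ connectedComponentIn {y | G y = 0} x :=
    (isPreconnected_setOfPred_mapClusterPt hK (.of_forall hwK)
      (h.tendsto_dist_succ hε)).subset_connectedComponentIn hx fun y hy =>
        h.eq_zero_of_mapClusterPt (hG y) hG_nonneg hG_sum hy
  exact tendsto_infDist_of_tendsto_nhdsSet
    (hK.tendsto_nhdsSet_of_mapClusterPt (.of_forall hwK) fun _ _ hy => hsub hy)

end IsPerturbedDescent

end PerturbedDescent

section MeasurableSelection

variable {Ω E : Type*} [MeasurableSpace Ω] [MeasurableSpace E]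

theorem exists_measurable_forall_of_seq {p : Ω → E → Prop} (q : ℕ → E)
    (hp : ∀ ω, ∃ n, p ω (q n)) (hp_meas : ∀ n, MeasurableSet {ω | p ω (q n)}) :
    ∃ g : Ω → E, Measurable g ∧ ∀ ω, p ω (g ω) := by
  classical
  exact ⟨fun ω => q (Nat.find (hp ω)), measurable_from_nat.comp (measurable_find hp hp_meas),
    fun ω => Nat.find_spec (hp ω)⟩

section Metric

variable [PseudoMetricSpace E] {F : Ω → Set E} {q : ℕ → E}

theorem exists_measurable_ball_refinement [OpensMeasurableSpace E] (hq : DenseRange q)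
    (hF_meas : ∀ U, IsOpen U → MeasurableSet {ω | (F ω ∩ U).Nonempty})
    {g : Ω → E} (hg : Measurable g) {r s : ℝ} (hs : 0 < s)
    (hgF : ∀ ω, (F ω ∩ Metric.ball (g ω) r).Nonempty) :
    ∃ g' : Ω → E, Measurable g' ∧
      ∀ ω, (F ω ∩ Metric.ball (g' ω) s).Nonempty ∧ dist (g ω) (g' ω) < r + s := by
  refine exists_measurable_forall_of_seq q
    (p := fun ω y => (F ω ∩ Metric.ball y s).Nonempty ∧ dist (g ω) y < r + s)
    (fun ω => ?_) fun n => ?_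
  · obtain ⟨y, hyF, hy⟩ := hgF ω
    obtain ⟨n, hn⟩ := hq.exists_dist_lt y hs
    rw [Metric.mem_ball'] at hy
    exact ⟨n, ⟨y, hyF, hn⟩, (dist_triangle _ y _).trans_lt (add_lt_add hy hn)⟩
  · exact (hF_meas _ Metric.isOpen_ball).inter
      (hg (Metric.isOpen_ball (x := q n) (ε := r + s)).measurableSet)

theorem exists_measurable_approx_seq [OpensMeasurableSpace E] (hq : DenseRange q)
    (hF_nonempty : ∀ ω, (F ω).Nonempty)
    (hF_meas : ∀ U, IsOpen U → MeasurableSet {ω | (F ω ∩ U).Nonempty}) :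
    ∃ g : ℕ → Ω → E, (∀ k, Measurable (g k)) ∧
      (∀ k ω, (F ω ∩ Metric.ball (g k ω) ((1 / 2) ^ k)).Nonempty) ∧
      ∀ k ω, dist (g k ω) (g (k + 1) ω) ≤ 2 * (1 / 2) ^ k := by
  obtain ⟨g₀, hg₀, hg₀F⟩ := exists_measurable_forall_of_seq q
    (p := fun ω y => (F ω ∩ Metric.ball y ((1 / 2) ^ 0)).Nonempty)
    (fun ω => by
      obtain ⟨y, hy⟩ := hF_nonempty ω
      obtain ⟨n, hn⟩ := hq.exists_dist_lt y (pow_pos one_half_pos 0)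
      exact ⟨n, y, hy, hn⟩)
    fun n => hF_meas _ Metric.isOpen_ball
  have hrefine (k : ℕ) (g : Ω → E)
      (hg : Measurable g ∧ ∀ ω, (F ω ∩ Metric.ball (g ω) ((1 / 2) ^ k)).Nonempty) :=
    exists_measurable_ball_refinement hq hF_meas hg.1 (pow_pos one_half_pos (k + 1)) hg.2
  have : Nonempty (Ω → E) := ⟨g₀⟩
  choose! next hnext_meas hnext using hrefine
  let g : ℕ → Ω → E := Nat.rec g₀ next
  have hg (k : ℕ) :
      Measurable (g k) ∧ ∀ ω, (F ω ∩ Metric.ball (g k ω) ((1 / 2) ^ k)).Nonempty := by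
    induction k with
    | zero => exact ⟨hg₀, hg₀F⟩
    | succ k ih => exact ⟨hnext_meas k (g k) ih, fun ω => (hnext k (g k) ih ω).1⟩
  refine ⟨g, fun k => (hg k).1, fun k => (hg k).2, fun k ω => ?_⟩
  calc dist (g k ω) (g (k + 1) ω) ≤ (1 / 2) ^ k + (1 / 2) ^ (k + 1) :=
        (hnext k (g k) (hg k) ω).2.le
    _ ≤ 2 * (1 / 2) ^ k := by
        rw [pow_succ]
        linarith [pow_pos (one_half_pos (α := ℝ)) k]

end Metric

theorem measurableSet_mapClusterPt_inter_nonempty [TopologicalSpace E] [SecondCountableTopology E]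
    [RegularSpace E] [OpensMeasurableSpace E] {f : ℕ → Ω → E} (hf : ∀ t, Measurable (f t))
    (hcomp : ∀ ω, ∃ K, IsCompact K ∧ ∀ t, f t ω ∈ K) {U : Set E} (hU : IsOpen U) :
    MeasurableSet {ω | ({x | MapClusterPt x atTop fun t => f t ω} ∩ U).Nonempty} := by
  set B := TopologicalSpace.countableBasis E
  have hB : TopologicalSpace.IsTopologicalBasis B := TopologicalSpace.isBasis_countableBasis E
  have heq : {ω | ({x | MapClusterPt x atTop fun t => f t ω} ∩ U).Nonempty} =
      ⋃ V ∈ {V ∈ B | closure V ⊆ U}, limsup (fun t => f t ⁻¹' V) atTop := by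
    ext ω
    simp only [Set.mem_iUnion, mem_limsup_iff_frequently_mem, exists_prop]
    constructor
    · rintro ⟨x, hx, hxU⟩
      obtain ⟨V, hVB, hxV, hVU⟩ := hB.exists_closure_subset (hU.mem_nhds hxU)
      exact ⟨V, ⟨hVB, hVU⟩, MapClusterPt.frequently hx ((hB.isOpen hVB).mem_nhds hxV)⟩
    · rintro ⟨V, ⟨-, hVU⟩, hV⟩
      obtain ⟨K, hK, hfK⟩ := hcomp ω
      obtain ⟨x, hx, hxf⟩ :=
        (hK.inter_right isClosed_closure).exists_mapClusterPt_of_frequently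
          (hV.mono fun t ht => ⟨hfK t, subset_closure ht⟩)
      exact ⟨x, hxf, hVU hx.2⟩
  rw [heq]
  exact .biUnion ((TopologicalSpace.countable_countableBasis E).mono fun V hV => hV.1)
    fun V hV => .measurableSet_limsup fun t => hf t (hB.isOpen hV.1).measurableSet

variable [TopologicalSpace E] [PolishSpace E] [BorelSpace E]

/-- The **Kuratowski–Ryll-Nardzewski selection theorem**. -/
theorem exists_measurable_selection {F : Ω → Set E} (hF_closed : ∀ ω, IsClosed (F ω))
    (hF_nonempty : ∀ ω, (F ω).Nonempty)
    (hF_meas : ∀ U, IsOpen U → MeasurableSet {ω | (F ω ∩ U).Nonempty}) :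
    ∃ ξ : Ω → E, Measurable ξ ∧ ∀ ω, ξ ω ∈ F ω := by
  let := TopologicalSpace.upgradeIsCompletelyMetrizable E
  rcases isEmpty_or_nonempty Ω with hΩ | ⟨⟨ω₀⟩⟩
  · exact ⟨isEmptyElim, measurable_of_empty _, isEmptyElim⟩
  have : Nonempty E := (hF_nonempty ω₀).to_type
  obtain ⟨g, hg_meas, hgF, hg_dist⟩ := exists_measurable_approx_seq
    (TopologicalSpace.denseRange_denseSeq E) hF_nonempty hF_meas
  choose ξ hξ using fun ω => cauchySeq_tendsto_of_complete
    (cauchySeq_of_le_geometric (1 / 2) 2 one_half_lt_one fun k => hg_dist k ω)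
  refine ⟨ξ, measurable_of_tendsto_metrizable hg_meas (tendsto_pi_nhds.2 hξ), fun ω => ?_⟩
  choose y hyF hy using fun k => hgF k ω
  have hdist : Tendsto (fun k => dist (g k ω) (y k)) atTop (𝓝 0) :=
    squeeze_zero (fun _ => dist_nonneg) (fun k => (Metric.mem_ball'.1 (hy k)).le)
      (tendsto_pow_atTop_nhds_zero_of_lt_one one_half_pos.le one_half_lt_one)
  exact (hF_closed ω).mem_of_tendsto ((hξ ω).congr_dist hdist) (.of_forall hyF)

theorem exists_measurable_mapClusterPt {f : ℕ → Ω → E} (hf : ∀ t, Measurable (f t))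
    (hcomp : ∀ ω, ∃ K, IsCompact K ∧ ∀ t, f t ω ∈ K) :
    ∃ ξ : Ω → E, Measurable ξ ∧ ∀ ω, MapClusterPt (ξ ω) atTop fun t => f t ω := by
  refine exists_measurable_selection (fun ω => isClosed_setOfPred_clusterPt) (fun ω => ?_)
    fun U hU => measurableSet_mapClusterPt_inter_nonempty hf hcomp hU
  obtain ⟨K, hK, hfK⟩ := hcomp ω
  obtain ⟨x, -, hx⟩ := hK.exists_mapClusterPt (f := atTop) (u := fun t => f t ω)
    (tendsto_principal.2 (.of_forall hfK))
  exact ⟨x, hx⟩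

theorem exists_measurable_ae_mapClusterPt {P : Measure Ω} {f : ℕ → Ω → E}
    (hf : ∀ t, Measurable (f t)) (hcomp : ∀ᵐ ω ∂P, ∃ K, IsCompact K ∧ ∀ t, f t ω ∈ K) :
    ∃ ξ : Ω → E, Measurable ξ ∧ ∀ᵐ ω ∂P, MapClusterPt (ξ ω) atTop fun t => f t ω := by
  classical
  obtain ⟨s, hs_ae, hs_meas, hs⟩ := hcomp.exists_measurable_mem
  let f' (t : ℕ) : Ω → E := s.piecewise (f t) (f 0)
  have hf'_eq {ω : Ω} (hω : ω ∈ s) : (fun t => f' t ω) = fun t => f t ω :=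
    funext fun t => Set.piecewise_eq_of_mem _ _ _ hω
  have hf'_comp (ω : Ω) : ∃ K, IsCompact K ∧ ∀ t, f' t ω ∈ K := by
    by_cases hω : ω ∈ s
    · exact (hs ω hω).imp fun K hK => ⟨hK.1, fun t => (congrFun (hf'_eq hω) t).symm ▸ hK.2 t⟩
    · exact ⟨{f 0 ω}, isCompact_singleton, fun t => Set.piecewise_eq_of_notMem _ _ _ hω⟩
  obtain ⟨ξ, hξ_meas, hξ⟩ := exists_measurable_mapClusterPt
    (fun t => (hf t).piecewise hs_meas (hf 0)) hf'_comp
  refine ⟨ξ, hξ_meas, ?_⟩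
  filter_upwards [hs_ae] with ω hω
  exact hf'_eq hω ▸ hξ ω

end MeasurableSelection

theorem mainTheorem2_general {Ω E : Type*} [MeasurableSpace Ω] {P : Measure Ω}
    [NormedAddCommGroup E] [NormedSpace ℝ E] [CompleteSpace E] [SecondCountableTopology E]
    [MeasurableSpace E] [BorelSpace E] {ε : ℕ → Ω → ℝ} {v δ w : ℕ → Ω → E}
    (hw_meas : ∀ t, Measurable (w t))
    (hdescent : ∀ᵐ ω ∂P, IsPerturbedDescent (ε · ω) (v · ω) (δ · ω) (w · ω))
    (hε : ∀ᵐ ω ∂P, Tendsto (ε · ω) atTop (𝓝 0))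
    (hcomp : ∀ᵐ ω ∂P, ∃ K, IsCompact K ∧ ∀ t, w t ω ∈ K)
    {G : E → ℝ} (hG : LowerSemicontinuous G) (hG_nonneg : ∀ x, 0 ≤ G x)
    (hG_sum : ∀ᵐ ω ∂P, Summable fun t => ε t ω * G (w t ω)) :
    ∃ ξ : Ω → E, Measurable ξ ∧ ∀ᵐ ω ∂P, ξ ω ∈ {x | G x = 0} ∧
      Tendsto (fun t => Metric.infDist (w t ω) (connectedComponentIn {x | G x = 0} (ξ ω)))
        atTop (𝓝 0) := by
  obtain ⟨ξ, hξ_meas, hξ⟩ := exists_measurable_ae_mapClusterPt hw_meas hcomp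
  refine ⟨ξ, hξ_meas, ?_⟩
  filter_upwards [hξ, hdescent, hε, hcomp, hG_sum] with ω hξω hω hεω ⟨K, hK, hwK⟩ hsum
  exact ⟨hω.eq_zero_of_mapClusterPt (hG _) hG_nonneg hsum hξω,
    hω.tendsto_infDist_connectedComponentIn hεω hK hwK hG hG_nonneg hsum hξω⟩

namespace AsyncNetwork

variable {M : ℕ} (N : AsyncNetwork M)

theorem coeff_nonneg (i j : Fin M) (t σ : ℕ) : 0 ≤ N.coeff i j t σ := by
  induction t using Nat.strong_induction_on generalizing i with
  | _ t ih =>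
    cases t with
    | zero =>
      rw [coeff, iterate]
      positivity
    | succ t =>
      rw [coeff_succ]
      exact add_nonneg (Finset.sum_nonneg fun k _ => mul_nonneg (N.a_nonneg i k t)
        (ih _ (Nat.lt_succ_of_le (N.tau_le i k t)) k)) (by positivity)

theorem limCoeff_nonneg (j : Fin M) (σ : ℕ) : 0 ≤ N.limCoeff j σ := by
  rw [limCoeff]
  split_ifs with h
  · exact ge_of_tendsto' (h.choose_spec j) fun t => N.coeff_nonneg j j t σ
  · exact le_rfl

variable {V : Type*} [AddCommGroup V] [Module ℝ V]

theorem agreement_succ (w0 : Fin M → V) (s : Fin M → ℕ → V) (t : ℕ) :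
    N.agreement w0 s (t + 1) = N.agreement w0 s t + ∑ j, N.limCoeff j (t + 1) • s j t := by
  rw [agreement, agreement, Finset.sum_range_succ, add_assoc]

variable {Ω : Type*} [MeasurableSpace Ω] [MeasurableSpace V] [MeasurableAdd₂ V]
  [MeasurableConstSMul ℝ V]

theorem measurable_iterate {w0 : Ω → Fin M → V} {s : Ω → Fin M → ℕ → V → V}
    (hw0 : ∀ i, Measurable fun ω => w0 ω i)
    (hs : ∀ i t, Measurable fun p : Ω × V => s p.1 i t p.2) (t : ℕ) (i : Fin M) :
    Measurable fun ω => N.iterate (w0 ω) (s ω) t i := by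
  induction t using Nat.strong_induction_on generalizing i with
  | _ t ih =>
    cases t with
    | zero => simpa only [iterate] using hw0 i
    | succ t =>
      simp only [iterate]
      exact (Finset.measurable_sum _ fun j _ =>
        (ih _ (Nat.lt_succ_of_le (N.tau_le i j t)) j).const_smul (N.a i j t)).add
          ((hs i t).comp (measurable_id.prodMk (ih t t.lt_succ_self i)))

theorem measurable_agreement {w0 : Ω → Fin M → V} {s : Ω → Fin M → ℕ → V}
    (hw0 : ∀ i, Measurable fun ω => w0 ω i) (hs : ∀ i t, Measurable fun ω => s ω i t) (t : ℕ) :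
    Measurable fun ω => N.agreement (w0 ω) (s ω) t :=
  (Finset.measurable_sum _ fun j _ => (hw0 j).const_smul _).add
    (Finset.measurable_sum _ fun τ _ => Finset.measurable_sum _ fun j _ =>
      (hs j τ).const_smul _)

end AsyncNetwork

section Quantization

variable {κ d : ℕ}

/-- Inference times out comparing the scalar actions on the nested `PiLp`. -/
instance instMeasurableConstSMulQuantizer : MeasurableConstSMul ℝ (Quantizer κ d) where
  measurable_const_smul c := (continuous_const_smul c).measurable

variable (μ : Measure (Pt d))

theorem measurableSet_mem_voronoiCell (ℓ : Fin κ) :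
    MeasurableSet {p : Pt d × Quantizer κ d | p.1 ∈ voronoiCell μ p.2 ℓ} := by
  have hcoord (k : Fin κ) : Measurable fun p : Pt d × Quantizer κ d => p.2 k := by fun_prop
  have heq (k : Fin κ) : MeasurableSet {p : Pt d × Quantizer κ d | p.2 k = p.2 ℓ} :=
    measurableSet_eq_fun (hcoord k) (hcoord ℓ)
  have hhull : MeasurableSet {p : Pt d × Quantizer κ d | p.1 ∈ hullSupport μ} :=
    measurable_fst isClosed_closedConvexHull.measurableSet
  have hmin : MeasurableSet {p : Pt d × Quantizer κ d | ∀ k, p.2 k = p.2 ℓ → ℓ ≤ k} := by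
    rw [Set.ofPred_forall]
    exact .iInter fun k => (heq k).imp (.const _)
  have hclosest : MeasurableSet
      {p : Pt d × Quantizer κ d | ∀ k, p.2 k ≠ p.2 ℓ → ‖p.2 ℓ - p.1‖ < ‖p.2 k - p.1‖} := by
    rw [Set.ofPred_forall]
    exact .iInter fun k => (heq k).compl.imp (measurableSet_lt
      ((hcoord ℓ).sub measurable_fst).norm ((hcoord k).sub measurable_fst).norm)
  exact hhull.inter (hmin.inter hclosest)

theorem measurable_gradObs :
    Measurable fun p : Pt d × Quantizer κ d => gradObs μ p.1 p.2 := by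
  refine (WithLp.measurable_toLp 2 _).comp (measurable_pi_lambda _ fun ℓ => ?_)
  have hdiff : Measurable fun p : Pt d × Quantizer κ d => p.2 ℓ - p.1 := by fun_prop
  exact hdiff.indicator (measurableSet_mem_voronoiCell μ ℓ)

end Quantization

namespace DALVQ

variable {M κ d : ℕ} (A : DALVQ M κ d) (μ : Measure (Pt d))

theorem weight_nonneg (j : Fin M) (t : ℕ) : 0 ≤ A.weight j t :=
  Set.indicator_nonneg (fun t _ => mul_nonneg (A.net.limCoeff_nonneg j (t + 1))
    (A.eps_mem j (t + 1)).1.le) t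

theorem epsStar_nonneg (t : ℕ) : 0 ≤ A.epsStar t :=
  Finset.sum_nonneg fun j _ => A.weight_nonneg j t

theorem limCoeff_smul_descent (z : Fin M → ℕ → Pt d) (j : Fin M) (t : ℕ) :
    A.net.limCoeff j (t + 1) • A.descent μ z j t =
      -(A.weight j t • gradObs μ (z j (t + 1)) (A.version μ z j t)) := by
  by_cases ht : t ∈ A.T j
  · simp only [descent, weight, Set.indicator_of_mem ht, smul_neg, smul_smul]
  · simp only [descent, weight, Set.indicator_of_notMem ht, smul_zero, zero_smul, neg_zero]

theorem wStar_succ (z : Fin M → ℕ → Pt d) (t : ℕ) :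
    A.wStar μ z (t + 1) = A.wStar μ z t - A.epsStar t • avgGrad μ (A.wStar μ z t) +
      (A.deltaM₁ μ z t + A.deltaM₂ μ z t) := by
  rw [wStar, AsyncNetwork.agreement_succ, ← wStar, sub_add, sub_eq_add_neg, add_right_inj,
    epsStar, deltaM₁, deltaM₂, Finset.sum_smul, ← Finset.sum_add_distrib,
    ← Finset.sum_sub_distrib, ← Finset.sum_neg_distrib]
  refine Finset.sum_congr rfl fun j _ => ?_
  rw [limCoeff_smul_descent, smul_sub, smul_sub]
  abel

theorem isPerturbedDescent_wStar {z : Fin M → ℕ → Pt d}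
    (h_sum : Tendsto (fun n => ∑ t ∈ Finset.range n, A.epsStar t) atTop atTop)
    (h_bdd : ∃ C, ∀ t, ‖avgGrad μ (A.wStar μ z t)‖ ≤ C)
    (h_M₁ : ∃ S, Tendsto (fun n => ∑ t ∈ Finset.range n, A.deltaM₁ μ z t) atTop (𝓝 S))
    (h_M₂ : ∃ S, Tendsto (fun n => ∑ t ∈ Finset.range n, A.deltaM₂ μ z t) atTop (𝓝 S)) :
    IsPerturbedDescent A.epsStar (fun t => avgGrad μ (A.wStar μ z t))
      (fun t => A.deltaM₁ μ z t + A.deltaM₂ μ z t) (A.wStar μ z) where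
  step_nonneg := A.epsStar_nonneg
  not_summable_step := (not_summable_iff_tendsto_nat_atTop_of_nonneg A.epsStar_nonneg).2 h_sum
  drift_bounded := h_bdd
  cauchySeq_sum_error := by
    simpa only [Finset.sum_add_distrib] using
      (h_M₁.choose_spec.add h_M₂.choose_spec).cauchySeq
  succ_eq := A.wStar_succ μ z

section Measurability

variable {Ω : Type*} [MeasurableSpace Ω] {z : Fin M → ℕ → Ω → Pt d}

theorem measurable_indicator_gradObs (i : Fin M) (t : ℕ) (hz : Measurable (z i (t + 1)))
    {w : Ω → Quantizer κ d} (hw : Measurable w) :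
    Measurable fun ω => (A.T i).indicator
      (fun t => -(A.eps i (t + 1) • gradObs μ (z i (t + 1) ω) (w ω))) t := by
  by_cases ht : t ∈ A.T i
  · simp only [Set.indicator_of_mem ht]
    exact (((measurable_gradObs μ).comp (hz.prodMk hw)).const_smul (A.eps i (t + 1))).neg
  · simp only [Set.indicator_of_notMem ht, measurable_const]

theorem measurable_version (hz : ∀ i t, Measurable (z i (t + 1))) (i : Fin M) (t : ℕ) :
    Measurable fun ω => A.version μ (fun i t => z i t ω) i t := by
  let s (ω : Ω) (i : Fin M) (t : ℕ) (w : Quantizer κ d) : Quantizer κ d :=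
    (A.T i).indicator (fun t => -(A.eps i (t + 1) • gradObs μ (z i (t + 1) ω) w)) t
  have hs (i : Fin M) (t : ℕ) : Measurable fun p : Ω × Quantizer κ d => s p.1 i t p.2 :=
    A.measurable_indicator_gradObs μ (z := fun i t (p : Ω × Quantizer κ d) => z i t p.1) i t
      ((hz i t).comp measurable_fst) measurable_snd
  exact A.net.measurable_iterate (w0 := fun _ => A.init) (s := s) (fun _ => measurable_const) hs t i

theorem measurable_descent (hz : ∀ i t, Measurable (z i (t + 1))) (i : Fin M) (t : ℕ) :
    Measurable fun ω => A.descent μ (fun i t => z i t ω) i t := by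
  have h := A.measurable_indicator_gradObs μ i t (hz i t) (A.measurable_version μ hz i t)
  by_cases ht : t ∈ A.T i
  · simpa only [descent, Set.indicator_of_mem ht] using h
  · simp only [descent, Set.indicator_of_notMem ht, measurable_const]

theorem measurable_wStar (hz : ∀ i t, Measurable (z i (t + 1))) (t : ℕ) :
    Measurable fun ω => A.wStar μ (fun i t => z i t ω) t :=
  A.net.measurable_agreement (w0 := fun _ => A.init)
    (s := fun ω => A.descent μ fun i t => z i t ω) (fun _ => measurable_const)
    (A.measurable_descent μ hz) t

end Measurability

end DALVQ

theorem mainTheorem2 {Ω : Type*} [MeasurableSpace Ω] (P : Measure Ω) [IsProbabilityMeasure P]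
    {M κ d : ℕ} (μ : Measure (Pt d)) [IsProbabilityMeasure μ] (hμ : CompactSupportedDensity μ)
    (A : DALVQ M κ d) (hA : A.net.AsY₁ ∨ A.net.AsY₂)
    -- the observations `z i t`, `t ≥ 1`, are independent with law `μ`
    (z : Fin M → ℕ → Ω → Pt d)
    (hz_meas : ∀ i t, Measurable (z i (t + 1)))
    (hz_law : ∀ i t, P.map (z i (t + 1)) = μ)
    (hz_indep : iIndepFun (fun p : Fin M × ℕ => z p.1 (p.2 + 1)) P)
    -- 1. steps
    (h_sum : Tendsto (fun n => ∑ t ∈ Finset.range n, A.epsStar t) atTop atTop)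
    (h_zero : Tendsto A.epsStar atTop (𝓝 0))
    -- 2. boundedness
    (h_bdd : ∀ᵐ ω ∂P, ∃ C : ℝ, ∀ t, ‖A.wStar μ (fun i t => z i t ω) t‖ ≤ C)
    (h_bdd' : ∀ᵐ ω ∂P, ∃ C : ℝ, ∀ t, ‖avgGrad μ (A.wStar μ (fun i t => z i t ω) t)‖ ≤ C)
    -- 3. convergence of the two series
    (h_M₁ : ∀ᵐ ω ∂P, ∃ S, Tendsto
      (fun n => ∑ t ∈ Finset.range n, A.deltaM₁ μ (fun i t => z i t ω) t) atTop (𝓝 S))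
    (h_M₂ : ∀ᵐ ω ∂P, ∃ S, Tendsto
      (fun n => ∑ t ∈ Finset.range n, A.deltaM₂ μ (fun i t => z i t ω) t) atTop (𝓝 S))
    -- 4. the function `G`
    (G : Quantizer κ d → ℝ) (hG_lsc : LowerSemicontinuous G) (hG_nonneg : ∀ x, 0 ≤ G x)
    (hG_sum : ∀ᵐ ω ∂P, Summable
      (fun t => A.epsStar t * G (A.wStar μ (fun i t => z i t ω) t))) :
    -- the random component is the one containing a random point `ξ` of `{G = 0}`
    ∃ ξ : Ω → Quantizer κ d, Measurable ξ ∧ ∀ᵐ ω ∂P, ξ ω ∈ {x | G x = 0} ∧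
      Tendsto (fun t => Metric.infDist (A.wStar μ (fun i t => z i t ω) t)
        (connectedComponentIn {x | G x = 0} (ξ ω))) atTop (𝓝 0) := by
  have hdescent : ∀ᵐ ω ∂P, IsPerturbedDescent A.epsStar
      (fun t => avgGrad μ (A.wStar μ (fun i t => z i t ω) t))
      (fun t => A.deltaM₁ μ (fun i t => z i t ω) t + A.deltaM₂ μ (fun i t => z i t ω) t)
      (A.wStar μ fun i t => z i t ω) := by
    filter_upwards [h_bdd', h_M₁, h_M₂] with ω hv h₁ h₂
    exact A.isPerturbedDescent_wStar μ h_sum hv h₁ h₂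
  have hcomp : ∀ᵐ ω ∂P, ∃ K, IsCompact K ∧ ∀ t, A.wStar μ (fun i t => z i t ω) t ∈ K := by
    filter_upwards [h_bdd] with ω ⟨C, hC⟩
    exact ⟨Metric.closedBall 0 C, isCompact_closedBall 0 C,
      fun t => mem_closedBall_zero_iff.2 (hC t)⟩
  exact mainTheorem2_general (A.measurable_wStar μ hz_meas) hdescent (.of_forall fun _ => h_zero)
    hcomp hG_lsc hG_nonneg hG_sum
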